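/- Let $\mathbb F_q$ be the finite field with $q=p^e$ elements and let $\mathcal P$ be a projective plane of order $q$. Coordinatise $\mathcal P$ by $\mathbb F_q$ as follows. Choose a triangle $O,X,Y$ and a point $I$ not collinear with any two of $O,X,Y$; label the points of the line $[0]=OY$ other than $Y$ bijectively as $(0,a)$, $a\in\mathbb F_q$, with $(0,0)=O$ and $(0,1)=XI\cap OY$. Write $(0)=X$, $(\infty)=Y$, $[\infty]=XY$, $[0,0]=OX$, and put $(1,0)=YI\cap OX$, $J=(1,0)(0,1)\cap[\infty]$, $(a,0)=(0,a)J\cap OX$, $(a)=(0,a)(1,0)\cap[\infty]$, $(a,b)=(a,0)Y\cap(0,b)X$; let $[m,k]$ be the line joining $(m)$ and $(0,k)$. The PTR polynomial $T\in\mathbb F_q[X,Y,Z]$ is the polynomial of degree less than $q$ in each variable with $T(m,x,y)=k$ if and only if $(x,y)\in[m,k]$. Put $x\oplus y=T(1,x,y)$ and $x\odot y=T(x,y,0)$. For a point $A$ and a line $\ell$ let $\Gamma(A,\ell)$ be the group of collineations fixing every point of $\ell$ and every line through $A$. The plane is $(A,\ell)$-transitive if for any two distinct points $B,C$ that are different from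 $A$, collinear with $A$ and not on $\ell$, some element of $\Gamma(A,\ell)$ maps $B$ to $C$. Let $\mathcal T$ be the set of all $(A,\ell)$ for which $\mathcal P$ is $(A,\ell)$-transitive. The plane is strictly of Lenz–Barlotti type I.4 if $\mathcal T=\{(A,BC),(B,CA),(C,AB)\}$ for some triangle $A,B,C$, and strictly of type II.2 if $\mathcal T=\{(A,a),(B,b)\}$ with $A\in a$, $B\notin b$, $A\in b$, $B\in a$. The coordinatisation is optimal if: (1) if $\mathcal T$ contains some $(A,a)$ with $A\in a$, then $((\infty),[\infty])\in\mathcal T$; (2) if $\mathcal T$ contains some $(A,a)$ with $A\notin a$, then $((0),[0])\in\mathcal T$; (3) if $\mathcal T$ contains some $(A,a),(B,b)$ with $A\notin a$, $B\notin b$, $A\in b$, $B\in a$, then $((0),[0])\in\mathcal T$ and $((\infty),[0,0])\in\mathcal T$. **Theorem.** Suppose that $\mathcal P$ is $((0),[0])$-transitive, that $\Gamma((0),[0])$ is cyclic, that the coordinatisation is optimal, and that $x\odot y=xy$ (the product in $\mathbb F_q$) for all $x,y\in\mathbb F_q$. (i) There are $b_{ij}\in\mathbb F_q$ such that $$T(X,Y,Z)=Z+XY+XYZ\,M_1(X,Y,Z),\qquad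 M_1(X,Y,Z)=\sum_{i,j=0}^{q-3}b_{ij}(XY)^iZ^j .$$ (ii) If $\mathcal P$ is strictly of Lenz–Barlotti type I.4, then there are $b_i\in\mathbb F_q$ such that this $M_1$ equals $$M_1(X,Y,Z)=\sum_{i=0}^{q-3}b_i(XY)^iZ^{q-2-i}.$$ (iii) If $\mathcal P$ is strictly of Lenz–Barlotti type II.2, then for all $x,y,z\in\mathbb F_q$, with $s=x+y+xy\,M_1(1,x,y)$ and $t=y+z+yz\,M_1(1,y,z)$, $$(x+y)z\,M_1(1,s,z)+xy\,M_1(1,x,y)\bigl(1+z\,M_1(1,s,z)\bigr)=x(y+z)\,M_1(1,x,t)+yz\,M_1(1,y,z)\bigl(1+x\,M_1(1,x,t)\bigr).$$ -/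

import Mathlib

open Configuration

noncomputable section

namespace CoordPlane

section Plane

variable {P L : Type*} [Membership P L] [ProjectivePlane P L]

open Classical in
/-- The line through two distinct points (some arbitrary line if the points coincide). -/
def join (p q : P) : L :=
  if h : p = q then (Nondegenerate.exists_line (L := L) p).choose
  else HasLines.mkLine (L := L) h

open Classical in
/-- The common point of two distinct lines (some arbitrary point if the lines coincide). -/
def meet (l m : L) : P :=
  if h : l = m then (Nondegenerate.exists_point (P := P) l).choose
  else HasPoints.mkPoint (P := P) h

theorem join_mem {p q : P} (h : p ≠ q) : p ∈ (join p q : L) ∧ q ∈ (join p q : L) := by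
  simp only [join, dif_neg h]
  exact HasLines.mkLine_ax h

theorem meet_mem {l m : L} (h : l ≠ m) : (meet l m : P) ∈ l ∧ (meet l m : P) ∈ m := by
  simp only [meet, dif_neg h]
  exact HasPoints.mkPoint_ax h

variable (P L)

/-- The full collineation group: pairs of a permutation of the points and a permutation of the
lines that preserve incidence in both directions. -/
def collineationGroup : Subgroup (Equiv.Perm P × Equiv.Perm L) where
  carrier := {g | ∀ (p : P) (l : L), g.1 p ∈ g.2 l ↔ p ∈ l}
  one_mem' := fun _ _ => Iff.rfl
  mul_mem' := by
    intro g h hg hh p l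
    exact (hg (h.1 p) (h.2 l)).trans (hh p l)
  inv_mem' := by
    intro g hg p l
    have := hg (g.1⁻¹ p) (g.2⁻¹ l)
    simpa using this.symm

variable {P L}

/-- `Γ(A, ℓ)`: the collineations that fix the axis `ℓ` pointwise and the centre `A` linewise. -/
def centralGroup (A : P) (l : L) : Subgroup (Equiv.Perm P × Equiv.Perm L) where
  carrier := {g | g ∈ collineationGroup P L ∧ (∀ p : P, p ∈ l → g.1 p = p) ∧
    (∀ m : L, A ∈ m → g.2 m = m)}
  one_mem' := ⟨one_mem _, fun _ _ => rfl, fun _ _ => rfl⟩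
  mul_mem' := by
    rintro g h ⟨hg, hgp, hgl⟩ ⟨hh, hhp, hhl⟩
    refine ⟨mul_mem hg hh, fun p hp => ?_, fun m hm => ?_⟩
    · change g.1 (h.1 p) = p
      rw [hhp p hp, hgp p hp]
    · change g.2 (h.2 m) = m
      rw [hhl m hm, hgl m hm]
  inv_mem' := by
    rintro g ⟨hg, hgp, hgl⟩
    refine ⟨inv_mem hg, fun p hp => ?_, fun m hm => ?_⟩
    · exact (Equiv.Perm.inv_eq_iff_eq).2 (hgp p hp).symm
    · exact (Equiv.Perm.inv_eq_iff_eq).2 (hgl m hm).symm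

/-- The plane is `(A, ℓ)`-transitive: any two distinct points `B`, `C`, different from `A`,
collinear with `A` and not on `ℓ`, are related by an element of `Γ(A, ℓ)`. -/
def IsTransitive (A : P) (l : L) : Prop :=
  ∀ B C : P, B ≠ C → B ≠ A → C ≠ A → B ∉ l → C ∉ l →
    (∃ m : L, A ∈ m ∧ B ∈ m ∧ C ∈ m) → ∃ g ∈ centralGroup A l, g.1 B = C

variable (P L)

/-- The set of all point-line pairs `(A, ℓ)` for which the plane is `(A, ℓ)`-transitive. -/
def transitivities : Set (P × L) := {x | IsTransitive x.1 x.2}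

/-- Lenz-Barlotti type (exactly) I.4: the transitivities are the three pairs
(vertex, opposite side) of a triangle. -/
def IsTypeI4 : Prop :=
  ∃ (A B C : P) (a b c : L), A ∉ a ∧ B ∉ b ∧ C ∉ c ∧
    A ∈ b ∧ A ∈ c ∧ B ∈ a ∧ B ∈ c ∧ C ∈ a ∧ C ∈ b ∧
    transitivities P L = {(A, a), (B, b), (C, c)}

/-- Lenz-Barlotti type (exactly) II.2: the transitivities are one incident pair `(A, a)` and one
non-incident pair `(B, b)` such that `A` lies on `b` and `B` lies on `a`. -/
def IsTypeII2 : Prop :=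
  ∃ (A B : P) (a b : L), A ∈ a ∧ B ∉ b ∧ A ∈ b ∧ B ∈ a ∧
    transitivities P L = {(A, a), (B, b)}

/-- Three points lie on a common line. -/
def Collinear3 (p q r : P) : Prop := ∃ l : L, p ∈ l ∧ q ∈ l ∧ r ∈ l

end Plane

/-- The choices made when the plane is coordinatised by a set `R` with elements `0` and `1`:
a triangle `O`, `X`, `Y`, a fourth point `I` not collinear with any two of these, and a labelling
`a ↦ (0, a)` of the points other than `Y` of the line `OY`, for which `(0, 0) = O` and
`(0, 1) = XI ∩ OY`. All other labels are determined by these, see below. -/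
structure Coordinatisation (R P L : Type*) [Zero R] [One R] [Membership P L]
    [ProjectivePlane P L] where
  O : P
  X : P
  Y : P
  I : P
  triangle : ¬ Collinear3 P L O X Y
  not_collinear_OX : ¬ Collinear3 P L I O X
  not_collinear_OY : ¬ Collinear3 P L I O Y
  not_collinear_XY : ¬ Collinear3 P L I X Y
  /-- the point `(0, a)` -/
  vpt : R → P
  vpt_bijOn : Set.BijOn vpt Set.univ {p | p ∈ (join O Y : L) ∧ p ≠ Y}
  vpt_zero : vpt 0 = O
  vpt_one : vpt 1 = meet (join X I : L) (join O Y : L)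

namespace Coordinatisation

variable {R P L : Type*} [Zero R] [One R] [Membership P L] [ProjectivePlane P L]
  (c : Coordinatisation R P L)

/-- The line `[∞] = XY`. -/
def lineInf : L := join c.X c.Y

/-- The line `[0] = OY`. -/
def lineOY : L := join c.O c.Y

/-- The line `[0, 0] = OX`. -/
def lineOX : L := join c.O c.X

/-- The point `(1, 0) = YI ∩ OX`. -/
def unitX : P := meet (join c.Y c.I : L) c.lineOX

/-- The point `J = (1)`, where the line through `(1, 0)` and `(0, 1)` meets `[∞]`. -/
def J : P := meet (join c.unitX (c.vpt 1) : L) c.lineInf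

/-- The point `(a, 0)`, where the line through `(0, a)` and `J` meets `[0, 0]`. -/
def hpt (a : R) : P := meet (join (c.vpt a) c.J : L) c.lineOX

/-- The point `(a)`, where the line through `(0, a)` and `(1, 0)` meets `[∞]`. -/
def slopePt (a : R) : P := meet (join (c.vpt a) c.unitX : L) c.lineInf

/-- The point `(a, b)`, where the line through `(a, 0)` and `Y` meets the line through
`(0, b)` and `X`. -/
def pt (a b : R) : P := meet (join (c.hpt a) c.Y : L) (join (c.vpt b) c.X : L)

/-- The line `[m, k]` through `(m)` and `(0, k)`. -/
def line (m k : R) : L := join (c.slopePt m) (c.vpt k)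

/-- The coordinatisation is optimal. Recall `X = (0)`, `Y = (∞)`.
* If the plane has an incident transitivity, then `((∞), [∞])` is one
  (this makes the addition associative).
* If the plane has a non-incident transitivity, then `((0), [0])` is one
  (this makes the multiplication associative).
* If the plane has two non-incident transitivities with the centre of each on the axis of the
  other, then `((0), [0])` and `((∞), [0, 0])` are such a pair
  (this gives in addition a left distributive law). -/
structure IsOptimal : Prop where
  incident : (∃ (A : P) (a : L), A ∈ a ∧ IsTransitive A a) → IsTransitive c.Y c.lineInf
  nonincident : (∃ (A : P) (a : L), A ∉ a ∧ IsTransitive A a) → IsTransitive c.X c.lineOY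
  nonincident_pair :
    (∃ (A B : P) (a b : L), A ∉ a ∧ B ∉ b ∧ A ∈ b ∧ B ∈ a ∧ IsTransitive A a ∧ IsTransitive B b) →
      IsTransitive c.X c.lineOY ∧ IsTransitive c.Y c.lineOX

end Coordinatisation

/-- `T` is the PTR polynomial obtained from the coordinatisation `c` by the finite field `F`: the
reduced polynomial with `T(m, x, y) = k` if and only if the point `(x, y)` is on the line
`[m, k]`. -/
structure IsPTRPolynomial {F P L : Type*} [Field F] [Fintype F] [Membership P L]
    [ProjectivePlane P L] (c : Coordinatisation F P L) (T : MvPolynomial (Fin 3) F) : Prop where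
  reduced : ∀ i : Fin 3, T.degreeOf i < Fintype.card F
  eval_eq_iff : ∀ m x y k : F, MvPolynomial.eval ![m, x, y] T = k ↔ c.pt x y ∈ c.line m k

end CoordPlane

end

/-! A collineation fixing X and Y that permutes the vertical lines, the points of OY other than Y
and the slopes by φ, κ, ψ satisfies T(ψm, φx, κy) = κ(T(m, x, y)), because all labels are recovered
by joining and intersecting. Each transitivity thus becomes an identity for T, and the values T(m,
x, 0) = mx make φ, κ, ψ explicit.

Homologies in Γ((0),[0]) give T(m, x, y) = T(1, mx, y), so T is determined by ⊕. Put D(x, z) = (x ⊕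
z - x - z)/(xz) and interpolate D on Fˣ × Fˣ. A priori the degrees go up to q-2, but the
coefficients of degree q-2 are sums of the form ∑ D(x, z) x, and these vanish because x ↦ x ⊕ z and
z ↦ x ⊕ z are permutations. This leaves degrees at most q-3, and comparison of reduced polynomials
gives (i).

In type I.4 optimality forces (O,[∞])-transitivity, so ⊕ commutes with scaling and D is homogeneous
of degree -1. Hence b i j survives only if q-1 divides i+j+1, that is, i+j = q-2. In type II.2 the
elations in Γ((∞),[∞]) make ⊕ associative, and (iii) is associativity written out. -/

namespace CoordPlane

/-! ### Incidence and central collineations. -/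

section Incidence

variable {P L : Type*} [Membership P L]

theorem ne_of_mem_of_notMem {p q : P} {l : L} (hp : p ∈ l) (hq : q ∉ l) : p ≠ q := by
  rintro rfl
  exact hq hp

theorem line_ne {p : P} {l m : L} (hl : p ∈ l) (hm : p ∉ m) : l ≠ m := by
  rintro rfl
  exact hm hl

theorem IsTransitive.exists_map_eq {A : P} {l : L} (h : IsTransitive A l) {B C : P}
    (hB : B ≠ A) (hC : C ≠ A) (hBl : B ∉ l) (hCl : C ∉ l) {m : L} (hAm : A ∈ m) (hBm : B ∈ m)
    (hCm : C ∈ m) : ∃ g ∈ centralGroup A l, g.1 B = C := by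
  by_cases hBC : B = C
  · exact ⟨1, one_mem _, hBC⟩
  · exact h B C hBC hB hC hBl hCl ⟨m, hAm, hBm, hCm⟩

variable [ProjectivePlane P L]

theorem line_unique {p q : P} {l m : L} (h : p ≠ q) (hpl : p ∈ l) (hql : q ∈ l) (hpm : p ∈ m)
    (hqm : q ∈ m) : l = m :=
  (Nondegenerate.eq_or_eq hpl hql hpm hqm).resolve_left h

theorem point_unique {p q : P} {l m : L} (h : l ≠ m) (hpl : p ∈ l) (hpm : p ∈ m) (hql : q ∈ l)
    (hqm : q ∈ m) : p = q :=
  (Nondegenerate.eq_or_eq hpl hql hpm hqm).resolve_right h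

theorem eq_join {p q : P} {l : L} (h : p ≠ q) (hp : p ∈ l) (hq : q ∈ l) : l = join p q :=
  line_unique h hp hq (join_mem h).1 (join_mem h).2

theorem eq_meet {p : P} {l m : L} (h : l ≠ m) (hl : p ∈ l) (hm : p ∈ m) : p = meet l m :=
  point_unique h hl hm (meet_mem h).1 (meet_mem h).2

/-- Any two points, distinct or not, lie on a common line. -/
theorem exists_line_through (p q : P) : ∃ l : L, p ∈ l ∧ q ∈ l := by
  by_cases h : p = q
  · subst h
    obtain ⟨p₁, p₂, p₃, l₁, l₂, l₃, h₁⟩ := ProjectivePlane.exists_config (P := P) (L := L)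
    have h13 : p₁ ≠ p₃ ∨ p₁ ≠ p₂ := by
      by_contra! h
      obtain ⟨h, h'⟩ := h
      subst h
      subst h'
      tauto
    have : ∃ r, p ≠ r := by
      by_cases hp : p = p₁
      · subst hp
        rcases h13 with h | h
        · exact ⟨_, h⟩
        · exact ⟨_, h⟩
      · exact ⟨_, hp⟩
    obtain ⟨r, hr⟩ := this
    exact ⟨join p r, (join_mem hr).1, (join_mem hr).1⟩
  · exact ⟨join p q, join_mem h⟩

theorem map_join {g : Equiv.Perm P × Equiv.Perm L} (hg : g ∈ collineationGroup P L) {p q : P}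
    (h : p ≠ q) : g.2 (join p q) = join (g.1 p) (g.1 q) :=
  eq_join (fun e => h (g.1.injective e)) ((hg p _).2 (join_mem h).1) ((hg q _).2 (join_mem h).2)

theorem map_meet {g : Equiv.Perm P × Equiv.Perm L} (hg : g ∈ collineationGroup P L) {l m : L}
    (h : l ≠ m) : g.1 (meet l m) = meet (g.2 l) (g.2 m) :=
  eq_meet (fun e => h (g.2.injective e)) ((hg _ l).2 (meet_mem h).1) ((hg _ m).2 (meet_mem h).2)

/-- The centre of a central collineation is fixed. -/
theorem map_center {A : P} {l m n : L} {g : Equiv.Perm P × Equiv.Perm L}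
    (hg : g ∈ centralGroup A l) (hmn : m ≠ n) (hm : A ∈ m) (hn : A ∈ n) : g.1 A = A := by
  obtain ⟨hg, -, hl⟩ := hg
  refine point_unique hmn ?_ ?_ hm hn
  · simpa [hl m hm] using (hg A m).2 hm
  · simpa [hl n hn] using (hg A n).2 hn

end Incidence

/-! ### Geometry of the coordinate labels. -/

namespace Coordinatisation

variable {F P L : Type*} [Field F] [Membership P L] [ProjectivePlane P L]
  (c : Coordinatisation F P L)

theorem O_ne_X : c.O ≠ c.X := fun h =>
  let ⟨l, h₁, h₂⟩ := exists_line_through (L := L) c.X c.Y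
  c.triangle ⟨l, h ▸ h₁, h₁, h₂⟩

theorem O_ne_Y : c.O ≠ c.Y := fun h =>
  let ⟨l, h₁, h₂⟩ := exists_line_through (L := L) c.X c.Y
  c.triangle ⟨l, h ▸ h₂, h₁, h₂⟩

theorem X_ne_Y : c.X ≠ c.Y := fun h =>
  let ⟨l, h₁, h₂⟩ := exists_line_through (L := L) c.O c.Y
  c.triangle ⟨l, h₁, h ▸ h₂, h₂⟩

theorem O_mem_lineOX : c.O ∈ c.lineOX := (join_mem c.O_ne_X).1
theorem X_mem_lineOX : c.X ∈ c.lineOX := (join_mem c.O_ne_X).2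
theorem O_mem_lineOY : c.O ∈ c.lineOY := (join_mem c.O_ne_Y).1
theorem Y_mem_lineOY : c.Y ∈ c.lineOY := (join_mem c.O_ne_Y).2
theorem X_mem_lineInf : c.X ∈ c.lineInf := (join_mem c.X_ne_Y).1
theorem Y_mem_lineInf : c.Y ∈ c.lineInf := (join_mem c.X_ne_Y).2

theorem X_notMem_lineOY : c.X ∉ c.lineOY := fun h =>
  c.triangle ⟨_, c.O_mem_lineOY, h, c.Y_mem_lineOY⟩

theorem Y_notMem_lineOX : c.Y ∉ c.lineOX := fun h =>
  c.triangle ⟨_, c.O_mem_lineOX, c.X_mem_lineOX, h⟩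

theorem O_notMem_lineInf : c.O ∉ c.lineInf := fun h =>
  c.triangle ⟨_, h, c.X_mem_lineInf, c.Y_mem_lineInf⟩

theorem lineOX_ne_lineOY : c.lineOX ≠ c.lineOY := line_ne c.X_mem_lineOX c.X_notMem_lineOY
theorem lineOX_ne_lineInf : c.lineOX ≠ c.lineInf := line_ne c.O_mem_lineOX c.O_notMem_lineInf
theorem lineOY_ne_lineInf : c.lineOY ≠ c.lineInf := line_ne c.O_mem_lineOY c.O_notMem_lineInf

theorem Y_ne_I : c.Y ≠ c.I := fun h =>
  let ⟨l, h₁, h₂⟩ := exists_line_through (L := L) c.X c.Y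
  c.not_collinear_XY ⟨l, h ▸ h₂, h₁, h₂⟩

theorem unitX_mem : c.unitX ∈ (join c.Y c.I : L) ∧ c.unitX ∈ c.lineOX :=
  meet_mem (line_ne (join_mem c.Y_ne_I).1 c.Y_notMem_lineOX)

theorem unitX_notMem_lineOY : c.unitX ∉ c.lineOY := fun h => by
  have hO : c.unitX = c.O :=
    point_unique c.lineOX_ne_lineOY c.unitX_mem.2 h c.O_mem_lineOX c.O_mem_lineOY
  have hm := c.unitX_mem.1
  rw [hO] at hm
  exact c.not_collinear_OY ⟨_, (join_mem c.Y_ne_I).2, hm, (join_mem c.Y_ne_I).1⟩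

theorem unitX_notMem_lineInf : c.unitX ∉ c.lineInf := fun h => by
  have hX : c.unitX = c.X :=
    point_unique c.lineOX_ne_lineInf c.unitX_mem.2 h c.X_mem_lineOX c.X_mem_lineInf
  have hm := c.unitX_mem.1
  rw [hX] at hm
  exact c.not_collinear_XY ⟨_, (join_mem c.Y_ne_I).2, hm, (join_mem c.Y_ne_I).1⟩

theorem vpt_mem (a : F) : c.vpt a ∈ c.lineOY := (c.vpt_bijOn.mapsTo (Set.mem_univ a)).1

theorem vpt_ne_Y (a : F) : c.vpt a ≠ c.Y := (c.vpt_bijOn.mapsTo (Set.mem_univ a)).2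

theorem vpt_injective : Function.Injective c.vpt := fun _ _ h =>
  c.vpt_bijOn.injOn (Set.mem_univ _) (Set.mem_univ _) h

theorem exists_vpt_eq {p : P} (h : p ∈ c.lineOY) (hY : p ≠ c.Y) : ∃ a, c.vpt a = p := by
  obtain ⟨a, -, ha⟩ := c.vpt_bijOn.surjOn ⟨h, hY⟩
  exact ⟨a, ha⟩

theorem vpt_notMem_lineInf (a : F) : c.vpt a ∉ c.lineInf := fun h =>
  c.vpt_ne_Y a (point_unique c.lineOY_ne_lineInf (c.vpt_mem a) h c.Y_mem_lineOY c.Y_mem_lineInf)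

theorem vpt_notMem_lineOX {a : F} (ha : a ≠ 0) : c.vpt a ∉ c.lineOX := fun h => by
  refine ha (c.vpt_injective ?_)
  rw [c.vpt_zero]
  exact point_unique c.lineOX_ne_lineOY h (c.vpt_mem a) c.O_mem_lineOX c.O_mem_lineOY

theorem vpt_ne_unitX (a : F) : c.vpt a ≠ c.unitX :=
  ne_of_mem_of_notMem (c.vpt_mem a) c.unitX_notMem_lineOY

theorem J_mem : c.J ∈ (join c.unitX (c.vpt 1) : L) ∧ c.J ∈ c.lineInf :=
  meet_mem (line_ne (join_mem (c.vpt_ne_unitX 1).symm).1 c.unitX_notMem_lineInf)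

theorem J_notMem_lineOX : c.J ∉ c.lineOX := fun h => by
  have h₁ := join_mem (L := L) (c.vpt_ne_unitX 1).symm
  have hne : c.J ≠ c.unitX := ne_of_mem_of_notMem c.J_mem.2 c.unitX_notMem_lineInf
  have e := line_unique hne c.J_mem.1 h₁.1 h c.unitX_mem.2
  exact c.vpt_notMem_lineOX one_ne_zero (e ▸ h₁.2)

theorem J_notMem_lineOY : c.J ∉ c.lineOY := fun h => by
  have h₁ := join_mem (L := L) (c.vpt_ne_unitX 1).symm
  have hne : c.J ≠ c.vpt 1 := ne_of_mem_of_notMem c.J_mem.2 (c.vpt_notMem_lineInf 1)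
  have e := line_unique hne c.J_mem.1 h₁.2 h (c.vpt_mem 1)
  exact c.unitX_notMem_lineOY (e ▸ h₁.1)

theorem vpt_ne_J (a : F) : c.vpt a ≠ c.J := ne_of_mem_of_notMem (c.vpt_mem a) c.J_notMem_lineOY

theorem hpt_mem (a : F) : c.hpt a ∈ (join (c.vpt a) c.J : L) ∧ c.hpt a ∈ c.lineOX :=
  meet_mem (line_ne (join_mem (c.vpt_ne_J a)).2 c.J_notMem_lineOX)

theorem hpt_notMem_lineInf (a : F) : c.hpt a ∉ c.lineInf := fun h => by
  have hJ : c.hpt a ≠ c.J := ne_of_mem_of_notMem (c.hpt_mem a).2 c.J_notMem_lineOX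
  have e := line_unique hJ (c.hpt_mem a).1 (join_mem (c.vpt_ne_J a)).2 h c.J_mem.2
  exact c.vpt_notMem_lineInf a (e ▸ (join_mem (c.vpt_ne_J a)).1)

theorem hpt_ne_Y (a : F) : c.hpt a ≠ c.Y :=
  ne_of_mem_of_notMem (c.hpt_mem a).2 c.Y_notMem_lineOX

theorem hpt_ne_X (a : F) : c.hpt a ≠ c.X := fun h =>
  c.hpt_notMem_lineInf a (h ▸ c.X_mem_lineInf)

theorem hpt_zero : c.hpt 0 = c.O := by
  refine (eq_meet (line_ne (join_mem (c.vpt_ne_J 0)).2 c.J_notMem_lineOX) ?_ c.O_mem_lineOX).symm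
  exact c.vpt_zero ▸ (join_mem (c.vpt_ne_J 0)).1

/-- Only the labelling of OY is onto by assumption, so `r` is projected from `J` to OY. For slopes
the same is done below from `unitX`. -/
theorem exists_hpt_eq {r : P} (h : r ∈ c.lineOX) (hX : r ≠ c.X) : ∃ a, c.hpt a = r := by
  have hJ : r ≠ c.J := ne_of_mem_of_notMem h c.J_notMem_lineOX
  have hj := join_mem (L := L) hJ
  have hp := meet_mem (P := P) (line_ne hj.2 c.J_notMem_lineOY)
  have hY : (meet (join r c.J : L) c.lineOY : P) ≠ c.Y := by
    intro e
    rw [e] at hp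
    have hJY : c.J ≠ c.Y := fun e => c.J_notMem_lineOY (e ▸ c.Y_mem_lineOY)
    have el := line_unique hJY hj.2 hp.1 c.J_mem.2 c.Y_mem_lineInf
    exact hX (point_unique c.lineOX_ne_lineInf h (el ▸ hj.1) c.X_mem_lineOX c.X_mem_lineInf)
  obtain ⟨a, ha⟩ := c.exists_vpt_eq hp.2 hY
  refine ⟨a, (eq_meet (line_ne (join_mem (c.vpt_ne_J a)).2 c.J_notMem_lineOX) ?_ h).symm⟩
  rw [← eq_join (c.vpt_ne_J a) (ha ▸ hp.1) hj.2]
  exact hj.1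

theorem slopePt_mem (a : F) :
    c.slopePt a ∈ (join (c.vpt a) c.unitX : L) ∧ c.slopePt a ∈ c.lineInf :=
  meet_mem (line_ne (join_mem (c.vpt_ne_unitX a)).2 c.unitX_notMem_lineInf)

theorem slopePt_ne_Y (a : F) : c.slopePt a ≠ c.Y := fun h => by
  have h₁ := (c.slopePt_mem a).1
  have h₂ := join_mem (L := L) (c.vpt_ne_unitX a)
  rw [h] at h₁
  have e := line_unique (c.vpt_ne_Y a) h₂.1 h₁ (c.vpt_mem a) c.Y_mem_lineOY
  exact c.unitX_notMem_lineOY (e ▸ h₂.2)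

theorem slopePt_zero : c.slopePt 0 = c.X := by
  have h := join_mem (L := L) (c.vpt_ne_unitX 0)
  refine (eq_meet (line_ne h.2 c.unitX_notMem_lineInf) ?_ c.X_mem_lineInf).symm
  rw [← eq_join (c.vpt_ne_unitX 0) (c.vpt_zero ▸ c.O_mem_lineOX) c.unitX_mem.2]
  exact c.X_mem_lineOX

theorem exists_slopePt_eq {r : P} (h : r ∈ c.lineInf) (hY : r ≠ c.Y) : ∃ a, c.slopePt a = r := by
  have hJ : r ≠ c.unitX := ne_of_mem_of_notMem h c.unitX_notMem_lineInf
  have hj := join_mem (L := L) hJ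
  have hp := meet_mem (P := P) (line_ne hj.2 c.unitX_notMem_lineOY)
  have hY : (meet (join r c.unitX : L) c.lineOY : P) ≠ c.Y := by
    intro e
    rw [e] at hp
    have el := line_unique hY hj.1 hp.1 h c.Y_mem_lineInf
    exact c.unitX_notMem_lineInf (el ▸ hj.2)
  obtain ⟨a, ha⟩ := c.exists_vpt_eq hp.2 hY
  refine ⟨a, (eq_meet (line_ne (join_mem (c.vpt_ne_unitX a)).2 c.unitX_notMem_lineInf) ?_ h).symm⟩
  rw [← eq_join (c.vpt_ne_unitX a) (ha ▸ hp.1) hj.2]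
  exact hj.1

/-- The vertical line through `(a, 0)` and `Y`. -/
noncomputable def vline (a : F) : L := join (c.hpt a) c.Y

/-- The horizontal line through `(0, b)` and `X`. -/
noncomputable def hline (b : F) : L := join (c.vpt b) c.X

theorem vpt_ne_X (a : F) : c.vpt a ≠ c.X :=
  ne_of_mem_of_notMem (c.vpt_mem a) c.X_notMem_lineOY

theorem hpt_mem_vline (a : F) : c.hpt a ∈ c.vline a := (join_mem (c.hpt_ne_Y a)).1
theorem Y_mem_vline (a : F) : c.Y ∈ c.vline a := (join_mem (c.hpt_ne_Y a)).2
theorem vpt_mem_hline (b : F) : c.vpt b ∈ c.hline b := (join_mem (c.vpt_ne_X b)).1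
theorem X_mem_hline (b : F) : c.X ∈ c.hline b := (join_mem (c.vpt_ne_X b)).2

theorem vline_ne_lineInf (a : F) : c.vline a ≠ c.lineInf :=
  line_ne (c.hpt_mem_vline a) (c.hpt_notMem_lineInf a)

theorem hline_ne_lineInf (b : F) : c.hline b ≠ c.lineInf :=
  line_ne (c.vpt_mem_hline b) (c.vpt_notMem_lineInf b)

theorem X_notMem_vline (a : F) : c.X ∉ c.vline a := fun h =>
  c.vline_ne_lineInf a (line_unique c.X_ne_Y h (c.Y_mem_vline a) c.X_mem_lineInf c.Y_mem_lineInf)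

theorem vline_ne_hline (a b : F) : c.vline a ≠ c.hline b :=
  (line_ne (c.X_mem_hline b) (c.X_notMem_vline a)).symm

theorem vline_zero : c.vline 0 = c.lineOY := by
  rw [vline, hpt_zero]
  rfl

theorem exists_vline_eq {l : L} (hY : c.Y ∈ l) (hl : l ≠ c.lineInf) : ∃ a, c.vline a = l := by
  have hm := meet_mem (P := P) (line_ne hY c.Y_notMem_lineOX)
  have hX : (meet l c.lineOX : P) ≠ c.X := by
    intro e
    rw [e] at hm
    exact hl (line_unique c.X_ne_Y hm.1 hY c.X_mem_lineInf c.Y_mem_lineInf)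
  obtain ⟨a, ha⟩ := c.exists_hpt_eq hm.2 hX
  exact ⟨a, (eq_join (c.hpt_ne_Y a) (ha ▸ hm.1) hY).symm⟩

theorem pt_eq (a b : F) : c.pt a b = meet (c.vline a) (c.hline b) := rfl

theorem pt_mem (a b : F) : c.pt a b ∈ c.vline a ∧ c.pt a b ∈ c.hline b :=
  meet_mem (c.vline_ne_hline a b)

theorem pt_notMem_lineInf (a b : F) : c.pt a b ∉ c.lineInf := fun h => by
  have hX := point_unique (c.hline_ne_lineInf b) (c.pt_mem a b).2 h (c.X_mem_hline b)
    c.X_mem_lineInf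
  exact c.X_notMem_vline a (hX ▸ (c.pt_mem a b).1)

theorem pt_zero_left (b : F) : c.pt 0 b = c.vpt b :=
  (eq_meet (c.vline_ne_hline 0 b) (c.vline_zero ▸ c.vpt_mem b) (c.vpt_mem_hline b)).symm

theorem slopePt_ne_vpt (m k : F) : c.slopePt m ≠ c.vpt k :=
  ne_of_mem_of_notMem (c.slopePt_mem m).2 (c.vpt_notMem_lineInf k)

theorem slopePt_mem_line (m k : F) : c.slopePt m ∈ c.line m k := (join_mem (c.slopePt_ne_vpt m k)).1
theorem vpt_mem_line (m k : F) : c.vpt k ∈ c.line m k := (join_mem (c.slopePt_ne_vpt m k)).2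

theorem line_ne_lineInf (m k : F) : c.line m k ≠ c.lineInf :=
  line_ne (c.vpt_mem_line m k) (c.vpt_notMem_lineInf k)

theorem Y_notMem_line (m k : F) : c.Y ∉ c.line m k := fun h =>
  c.line_ne_lineInf m k (line_unique (c.slopePt_ne_Y m) (c.slopePt_mem_line m k) h
    (c.slopePt_mem m).2 c.Y_mem_lineInf)

theorem line_zero_left (k : F) : c.line 0 k = c.hline k :=
  (eq_join (c.vpt_ne_X k) (c.vpt_mem_line 0 k) (c.slopePt_zero ▸ c.slopePt_mem_line 0 k))

theorem pt_right_injective (a : F) : Function.Injective (c.pt a) := fun b b' h => by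
  have hX : c.pt a b ≠ c.X := fun e => c.pt_notMem_lineInf a b (e ▸ c.X_mem_lineInf)
  have e := line_unique hX (c.pt_mem a b).2 (c.X_mem_hline b) (h ▸ (c.pt_mem a b').2)
    (c.X_mem_hline b')
  refine c.vpt_injective (point_unique (line_ne (c.X_mem_hline b) c.X_notMem_lineOY)
    (c.vpt_mem_hline b) (c.vpt_mem b) (e ▸ c.vpt_mem_hline b') (c.vpt_mem b'))

end Coordinatisation

/-! ### Identities for T forced by transitivities. -/

namespace IsPTRPolynomial

variable {F P L : Type*} [Field F] [Fintype F] [Membership P L] [ProjectivePlane P L]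
  {c : Coordinatisation F P L} {T : MvPolynomial (Fin 3) F}

open MvPolynomial

theorem eval_zero_left (hT : IsPTRPolynomial c T) (x y : F) : eval ![0, x, y] T = y :=
  (hT.eval_eq_iff _ _ _ _).2 (c.line_zero_left y ▸ (c.pt_mem x y).2)

theorem eval_zero_mid (hT : IsPTRPolynomial c T) (m y : F) : eval ![m, 0, y] T = y :=
  (hT.eval_eq_iff _ _ _ _).2 (c.pt_zero_left y ▸ c.vpt_mem_line m y)

theorem pt_mem_line (hT : IsPTRPolynomial c T) (m x y : F) :
    c.pt x y ∈ c.line m (eval ![m, x, y] T) :=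
  (hT.eval_eq_iff _ _ _ _).1 rfl

theorem eval_right_injective (hT : IsPTRPolynomial c T) (m x : F) :
    Function.Injective fun y => eval ![m, x, y] T := fun y y' h => by
  refine c.pt_right_injective x (point_unique (line_ne (c.Y_mem_vline x) (c.Y_notMem_line m _))
    (c.pt_mem x y).1 (hT.pt_mem_line m x y) (c.pt_mem x y').1 ?_)
  exact (hT.eval_eq_iff _ _ _ _).1 h.symm

/-- The vertical line determines the point (x, 0), which lies on [1, k] only for k = 1 · x = x. -/
theorem vline_injective (hT : IsPTRPolynomial c T)
    (hmul : ∀ x y : F, eval ![x, y, 0] T = x * y) : Function.Injective c.vline := fun x x' h => by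
  have h₁ := hT.pt_mem_line 1 x 0
  rw [c.pt_eq, h, ← c.pt_eq, ← hT.eval_eq_iff, hmul, hmul] at h₁
  simpa using h₁.symm

theorem slopePt_injective (hT : IsPTRPolynomial c T)
    (hmul : ∀ x y : F, eval ![x, y, 0] T = x * y) : Function.Injective c.slopePt := fun m m' h => by
  have h₁ := hT.pt_mem_line m 1 0
  rw [Coordinatisation.line, h, ← Coordinatisation.line, ← hT.eval_eq_iff, hmul, hmul] at h₁
  simpa using h₁.symm

/-- For x ≠ 0 the points (x, y) and (0, k) are distinct, so a single line joins them and its slope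
is unique. -/
theorem eval_left_injective (hT : IsPTRPolynomial c T)
    (hmul : ∀ x y : F, eval ![x, y, 0] T = x * y) {x : F} (hx : x ≠ 0) (y : F) :
    Function.Injective fun m => eval ![m, x, y] T := fun m m' h => by
  have hne : c.pt x y ≠ c.vpt (eval ![m, x, y] T) := by
    intro e
    refine hx (vline_injective hT hmul ?_)
    rw [c.vline_zero]
    exact line_unique (c.vpt_ne_Y _) (e ▸ (c.pt_mem x y).1) (c.Y_mem_vline x) (c.vpt_mem _)
      c.Y_mem_lineOY
  have e := line_unique hne (hT.pt_mem_line m x y) (c.vpt_mem_line m _)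
    ((hT.eval_eq_iff _ _ _ _).1 h.symm) (c.vpt_mem_line m' _)
  exact slopePt_injective hT hmul (point_unique (c.line_ne_lineInf m _) (c.slopePt_mem_line m _)
    (c.slopePt_mem m).2 (e ▸ c.slopePt_mem_line m' _) (c.slopePt_mem m').2)

/-- A collineation that fixes `X` and `Y` and acts on the vertical lines, on the points of `OY`
and on the slopes through `φ`, `κ` and `ψ` induces an isotopism of `T`. -/
theorem eval_map (hT : IsPTRPolynomial c T) {g : Equiv.Perm P × Equiv.Perm L}
    (hg : g ∈ collineationGroup P L) (hX : g.1 c.X = c.X) {φ κ ψ : F → F}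
    (hφ : ∀ x, g.2 (c.vline x) = c.vline (φ x)) (hκ : ∀ k, g.1 (c.vpt k) = c.vpt (κ k))
    (hψ : ∀ m, g.1 (c.slopePt m) = c.slopePt (ψ m)) (m x y : F) :
    eval ![ψ m, φ x, κ y] T = κ (eval ![m, x, y] T) := by
  have h := (hg _ _).2 (hT.pt_mem_line m x y)
  rw [Coordinatisation.line, map_join hg (c.slopePt_ne_vpt _ _), hψ, hκ, c.pt_eq,
    map_meet hg (c.vline_ne_hline _ _), hφ, Coordinatisation.hline, map_join hg (c.vpt_ne_X _),
    hκ, hX] at h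
  exact (hT.eval_eq_iff _ _ _ _).2 h

/-- Take the homology moving (1, 0) to (m, 0). It fixes OY pointwise, so κ = id, and y = 0 yields
ψ(n) φ(x) = n x. From φ(1) = m follow ψ(m) = 1 and φ(x) = m x. -/
theorem eval_eq_of_isTransitive_X (hT : IsPTRPolynomial c T)
    (hmul : ∀ x y : F, eval ![x, y, 0] T = x * y) (h : IsTransitive c.X c.lineOY) (m x y : F) :
    eval ![m, x, y] T = eval ![1, m * x, y] T := by
  by_cases hm : m = 0
  · rw [hm, zero_mul, hT.eval_zero_left, hT.eval_zero_mid]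
  have hOY : ∀ a : F, a ≠ 0 → c.hpt a ∉ c.lineOY := fun a ha h' => by
    refine ha (vline_injective hT hmul ?_)
    rw [c.vline_zero]
    exact line_unique (c.hpt_ne_Y a) (c.hpt_mem_vline a) (c.Y_mem_vline a) h' c.Y_mem_lineOY
  obtain ⟨g, hg, hgm⟩ := h.exists_map_eq (c.hpt_ne_X 1) (c.hpt_ne_X m) (hOY 1 one_ne_zero)
    (hOY m hm) c.X_mem_lineOX (c.hpt_mem 1).2 (c.hpt_mem m).2
  have hX := map_center hg c.lineOX_ne_lineInf c.X_mem_lineOX c.X_mem_lineInf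
  obtain ⟨hgc, hp, hl⟩ := hg
  have hY := hp _ c.Y_mem_lineOY
  have hInf := hl _ c.X_mem_lineInf
  have hφ : ∀ x, ∃ x', g.2 (c.vline x) = c.vline x' := fun x => by
    obtain ⟨a, ha⟩ := c.exists_vline_eq (l := g.2 (c.vline x))
      (hY ▸ (hgc _ _).2 (c.Y_mem_vline x))
      (fun e => c.vline_ne_lineInf x (g.2.injective (e.trans hInf.symm)))
    exact ⟨a, ha.symm⟩
  have hψ : ∀ m, ∃ m', g.1 (c.slopePt m) = c.slopePt m' := fun m => by
    obtain ⟨a, ha⟩ := c.exists_slopePt_eq (r := g.1 (c.slopePt m))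
      (hInf ▸ (hgc _ _).2 (c.slopePt_mem m).2)
      (fun e => c.slopePt_ne_Y m (g.1.injective (e.trans hY.symm)))
    exact ⟨a, ha.symm⟩
  choose φ hφ using hφ
  choose ψ hψ using hψ
  have key := hT.eval_map hgc hX hφ (κ := id) (fun k => hp _ (c.vpt_mem k)) hψ
  have h1 : φ 1 = m := by
    refine vline_injective hT hmul ?_
    rw [← hφ, Coordinatisation.vline, map_join hgc (c.hpt_ne_Y 1), hgm, hY]
    rfl
  have key0 : ∀ n x, ψ n * φ x = n * x := fun n x => by
    have := key n x 0
    simpa only [id, hmul] using this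
  have hψm : ψ m = 1 := by
    have := key0 m 1
    rw [h1, mul_one] at this
    exact mul_right_cancel₀ hm (this.trans (one_mul m).symm)
  have hφx : φ x = m * x := by
    have := key0 m x
    rwa [hψm, one_mul] at this
  have := key m x y
  rw [hψm, hφx] at this
  exact this.symm

/-- The homology moving (0, 1) to (0, a) fixes all slopes. Setting y = 0 gives m φ(x) = κ(m x), so φ
and κ are both multiplication by κ(1) = a. -/
theorem eval_smul_of_isTransitive_O (hT : IsPTRPolynomial c T)
    (hmul : ∀ x y : F, eval ![x, y, 0] T = x * y) (h : IsTransitive c.O c.lineInf)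
    {a : F} (ha : a ≠ 0) (x y : F) :
    eval ![1, a * x, a * y] T = a * eval ![1, x, y] T := by
  have hO : ∀ a : F, a ≠ 0 → c.vpt a ≠ c.O := fun a ha h' =>
    ha (c.vpt_injective (h'.trans c.vpt_zero.symm))
  obtain ⟨g, hg, hga⟩ := h.exists_map_eq (hO 1 one_ne_zero) (hO a ha) (c.vpt_notMem_lineInf 1)
    (c.vpt_notMem_lineInf a) c.O_mem_lineOY (c.vpt_mem 1) (c.vpt_mem a)
  have hgO := map_center hg c.lineOX_ne_lineOY c.O_mem_lineOX c.O_mem_lineOY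
  obtain ⟨hgc, hp, hl⟩ := hg
  have hX := hp _ c.X_mem_lineInf
  have hY := hp _ c.Y_mem_lineInf
  have hInf : g.2 c.lineInf = c.lineInf := by
    conv_lhs => rw [Coordinatisation.lineInf, map_join hgc c.X_ne_Y, hX, hY]
    rfl
  have hφ : ∀ x, ∃ x', g.2 (c.vline x) = c.vline x' := fun x => by
    obtain ⟨a, ha⟩ := c.exists_vline_eq (l := g.2 (c.vline x))
      (hY ▸ (hgc _ _).2 (c.Y_mem_vline x))
      (fun e => c.vline_ne_lineInf x (g.2.injective (e.trans hInf.symm)))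
    exact ⟨a, ha.symm⟩
  have hκ : ∀ k, ∃ k', g.1 (c.vpt k) = c.vpt k' := fun k => by
    obtain ⟨a, ha⟩ := c.exists_vpt_eq (p := g.1 (c.vpt k))
      (hl _ c.O_mem_lineOY ▸ (hgc _ _).2 (c.vpt_mem k))
      (fun e => c.vpt_ne_Y k (g.1.injective (e.trans hY.symm)))
    exact ⟨a, ha.symm⟩
  choose φ hφ using hφ
  choose κ hκ using hκ
  have key := hT.eval_map hgc hX hφ hκ (ψ := id) (fun m => hp _ (c.slopePt_mem m).2)
  have hκ0 : κ 0 = 0 := c.vpt_injective (by rw [← hκ, c.vpt_zero, hgO])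
  have hκ1 : κ 1 = a := c.vpt_injective (by rw [← hκ, hga])
  have key0 : ∀ m x, m * φ x = κ (m * x) := fun m x => by
    have := key m x 0
    rwa [hκ0, hmul, hmul] at this
  have hφκ : ∀ x, φ x = κ x := fun x => by simpa using key0 1 x
  have hκx : ∀ x, κ x = a * x := fun x => by
    have := key0 x 1
    rw [hφκ, hκ1, mul_one] at this
    rw [← this, mul_comm]
  have := key 1 x y
  rwa [hφκ, hκx, hκx, hκx] at this

/-- The elation moving (0, 0) to (0, z) fixes vertical lines and slopes, and y = 0 shows that it
acts on OY as κ(x) = x ⊕ z. -/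
theorem eval_assoc_of_isTransitive_Y (hT : IsPTRPolynomial c T)
    (hmul : ∀ x y : F, eval ![x, y, 0] T = x * y) (h : IsTransitive c.Y c.lineInf) (x y z : F) :
    eval ![1, x, eval ![1, y, z] T] T = eval ![1, eval ![1, x, y] T, z] T := by
  obtain ⟨g, hg, hgz⟩ := h.exists_map_eq (c.vpt_ne_Y 0) (c.vpt_ne_Y z) (c.vpt_notMem_lineInf 0)
    (c.vpt_notMem_lineInf z) c.Y_mem_lineOY (c.vpt_mem 0) (c.vpt_mem z)
  obtain ⟨hgc, hp, hl⟩ := hg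
  have hX := hp _ c.X_mem_lineInf
  have hY := hp _ c.Y_mem_lineInf
  have hκ : ∀ k, ∃ k', g.1 (c.vpt k) = c.vpt k' := fun k => by
    obtain ⟨a, ha⟩ := c.exists_vpt_eq (p := g.1 (c.vpt k))
      (hl _ c.Y_mem_lineOY ▸ (hgc _ _).2 (c.vpt_mem k))
      (fun e => c.vpt_ne_Y k (g.1.injective (e.trans hY.symm)))
    exact ⟨a, ha.symm⟩
  choose κ hκ using hκ
  have key := hT.eval_map hgc hX (φ := id) (fun x => hl _ (c.Y_mem_vline x)) hκ (ψ := id)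
    (fun m => hp _ (c.slopePt_mem m).2)
  have hκ0 : κ 0 = z := c.vpt_injective (by rw [← hκ, hgz])
  have hκx : ∀ x, κ x = eval ![1, x, z] T := fun x => by
    have := key 1 x 0
    rw [hκ0, hmul, one_mul] at this
    exact this.symm
  have := key 1 x y
  rwa [hκx, hκx] at this

end IsPTRPolynomial

/-- For a plane of type I.4 with an optimal coordinatisation the third transitivity is
`(O, [∞])`. -/
theorem IsTypeI4.isTransitive_O {F P L : Type*} [Field F] [Membership P L] [ProjectivePlane P L]
    {c : Coordinatisation F P L} (hopt : c.IsOptimal) (h : IsTypeI4 P L) :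
    IsTransitive c.O c.lineInf := by
  obtain ⟨A, B, C, a, b, d, hAa, hBb, hCd, hAb, hAd, hBa, hBd, hCa, hCb, hS⟩ := h
  have mem : ∀ x : P × L, IsTransitive x.1 x.2 ↔ x = (A, a) ∨ x = (B, b) ∨ x = (C, d) := fun x => by
    change x ∈ transitivities P L ↔ _
    rw [hS]
    rfl
  have hA : IsTransitive A a := (mem (A, a)).2 (by simp)
  have hB : IsTransitive B b := (mem (B, b)).2 (by simp)
  have hC : IsTransitive C d := (mem (C, d)).2 (by simp)
  obtain ⟨h₁, h₂⟩ := hopt.nonincident_pair ⟨A, B, a, b, hAa, hBb, hAb, hBa, hA, hB⟩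
  -- X and Y are two vertices of the triangle, with opposite sides OY and OX. The third vertex lies
  -- on both sides, hence is O, and its opposite side is XY.
  have third : ∀ (C : P) (d : L), C ∈ c.lineOY → C ∈ c.lineOX → c.X ∈ d → c.Y ∈ d →
      IsTransitive C d → IsTransitive c.O c.lineInf := fun C d h₁ h₂ h₃ h₄ h₅ => by
    rwa [point_unique c.lineOX_ne_lineOY h₂ h₁ c.O_mem_lineOX c.O_mem_lineOY,
      line_unique c.X_ne_Y h₃ h₄ c.X_mem_lineInf c.Y_mem_lineInf] at h₅
  rcases (mem (c.X, c.lineOY)).1 h₁ with e | e | e <;>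
    rcases (mem (c.Y, c.lineOX)).1 h₂ with e' | e' | e' <;>
    obtain ⟨eX, e₁⟩ := Prod.mk.inj e <;> obtain ⟨eY, e₂⟩ := Prod.mk.inj e' <;>
    first
    | exact absurd (eX.trans eY.symm) c.X_ne_Y
    | exact third A a (e₁ ▸ ‹_›) (e₂ ▸ ‹_›) (eX ▸ ‹_›) (eY ▸ ‹_›) hA
    | exact third B b (e₁ ▸ ‹_›) (e₂ ▸ ‹_›) (eX ▸ ‹_›) (eY ▸ ‹_›) hB
    | exact third C d (e₁ ▸ ‹_›) (e₂ ▸ ‹_›) (eX ▸ ‹_›) (eY ▸ ‹_›) hC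

end CoordPlane
namespace CoordPlane

/-! ### Interpolation on Fˣ and Fˣ × Fˣ. -/

section Interpolation

variable {F : Type*} [Field F] [Fintype F]

/-- A geometric sum over q-1 terms with ratio u/v: it is q-1 = -1 for ratio 1, and otherwise
vanishes since (u/v)^(q-1) = 1. -/
theorem sum_range_mul_pow_inv [DecidableEq F] {u v : F} (hu : u ≠ 0) (hv : v ≠ 0) :
    ∑ i ∈ Finset.range (Fintype.card F - 1), v⁻¹ ^ i * u ^ i = if v = u then -1 else 0 := by
  simp_rw [← mul_pow]
  have hq : 1 ≤ Fintype.card F := Fintype.card_pos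
  split_ifs with h
  · subst h
    simp [inv_mul_cancel₀ hu, Nat.cast_sub hq]
  · have hne : v⁻¹ * u ≠ 1 := fun e => h (by
      field_simp at e
      exact e.symm)
    rw [geom_sum_eq hne, FiniteField.pow_card_sub_one_eq_one _ (mul_ne_zero (inv_ne_zero hv) hu),
      sub_self, zero_div]

/-- Interpolation on `Fˣ` by polynomials of degree less than `q - 2`, for functions whose
coefficient in degree `q - 2` vanishes. -/
theorem sum_range_interpolation {f : F → F} (h0 : f 0 = 0) (hf : ∑ v, f v * v = 0) {u : F}
    (hu : u ≠ 0) :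
    ∑ i ∈ Finset.range (Fintype.card F - 2), (∑ v, f v * v⁻¹ ^ i) * u ^ i = -f u := by
  classical
  have hq : 1 < Fintype.card F := Fintype.one_lt_card
  have hpow : ∀ v : F, v ≠ 0 → v⁻¹ ^ (Fintype.card F - 2) = v := fun v hv => by
    have h := FiniteField.pow_card_sub_one_eq_one v hv
    rw [show Fintype.card F - 1 = Fintype.card F - 2 + 1 by omega, pow_succ] at h
    rw [inv_pow]
    exact inv_eq_of_mul_eq_one_right h
  -- As v⁻¹ ^ (q-2) = v on Fˣ, this is the hypothesis `hf`; it allows the term i = q-2 to be added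
  -- and the orthogonality relation to be used.
  have htop : ∑ v, f v * v⁻¹ ^ (Fintype.card F - 2) = 0 := by
    rw [← hf]
    refine Finset.sum_congr rfl fun v _ => ?_
    by_cases hv : v = 0
    · simp [hv, h0]
    · rw [hpow v hv]
  have hsum : ∑ i ∈ Finset.range (Fintype.card F - 2), (∑ v, f v * v⁻¹ ^ i) * u ^ i =
      ∑ i ∈ Finset.range (Fintype.card F - 1), (∑ v, f v * v⁻¹ ^ i) * u ^ i := by
    rw [show Fintype.card F - 1 = Fintype.card F - 2 + 1 by omega, Finset.sum_range_succ, htop,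
      zero_mul, add_zero]
  rw [hsum]
  simp_rw [Finset.sum_mul, mul_assoc]
  rw [Finset.sum_comm]
  simp_rw [← Finset.mul_sum]
  rw [Finset.sum_eq_single u]
  · rw [sum_range_mul_pow_inv hu hu, if_pos rfl, mul_neg_one]
  · intro v _ hv
    by_cases hv0 : v = 0
    · simp [hv0, h0]
    · rw [sum_range_mul_pow_inv hu hv0, if_neg hv, mul_zero]
  · simp

/-- The coefficients of the polynomial interpolating `H` on `Fˣ × Fˣ`. -/
def interpCoeff (H : F → F → F) (i j : ℕ) : F :=
  ∑ v, (∑ w, H v w * w⁻¹ ^ j) * v⁻¹ ^ i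

theorem sum_interpCoeff {H : F → F → F} (h0 : ∀ w, H 0 w = 0) (h0' : ∀ v, H v 0 = 0)
    (hl : ∀ w, ∑ v, H v w * v = 0) (hr : ∀ v, ∑ w, H v w * w = 0) {u z : F} (hu : u ≠ 0)
    (hz : z ≠ 0) :
    ∑ i ∈ Finset.range (Fintype.card F - 2), ∑ j ∈ Finset.range (Fintype.card F - 2),
      interpCoeff H i j * u ^ i * z ^ j = H u z := by
  rw [Finset.sum_comm]
  -- Interpolate in the first variable, then in the second; each contributes a sign -1, and the two
  -- cancel.
  have h : ∀ j, ∑ i ∈ Finset.range (Fintype.card F - 2), interpCoeff H i j * u ^ i =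
      -∑ w, H u w * w⁻¹ ^ j := fun j => by
    refine sum_range_interpolation (f := fun v => ∑ w, H v w * w⁻¹ ^ j) (by simp [h0]) ?_ hu
    simp_rw [Finset.sum_mul]
    rw [Finset.sum_comm]
    refine Finset.sum_eq_zero fun w _ => ?_
    simp_rw [mul_right_comm _ (w⁻¹ ^ j)]
    rw [← Finset.sum_mul, hl, zero_mul]
  simp_rw [← Finset.sum_mul, h, neg_mul, Finset.sum_neg_distrib]
  rw [sum_range_interpolation (h0' u) (hr u) hz, neg_neg]

/-- Substitute v ↦ a v and w ↦ a w in the defining sums. -/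
theorem interpCoeff_homogeneous {H : F → F → F} {a : F} (ha : a ≠ 0)
    (hH : ∀ u z, H (a * u) (a * z) = a⁻¹ * H u z) (i j : ℕ) :
    interpCoeff H i j = a⁻¹ ^ (i + j + 1) * interpCoeff H i j := by
  have hb : Function.Bijective fun x : F => a * x := mulLeft_bijective₀ a ha
  conv_lhs => rw [interpCoeff, ← hb.sum_comp]
  rw [interpCoeff, Finset.mul_sum]
  refine Finset.sum_congr rfl fun v _ => ?_
  rw [← hb.sum_comp, Finset.sum_mul, Finset.sum_mul, Finset.mul_sum]
  refine Finset.sum_congr rfl fun w _ => ?_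
  rw [hH, mul_inv, mul_inv, mul_pow, mul_pow]
  ring

/-- Apply homogeneity to a generator of Fˣ: a nonzero coefficient forces its power i+j+1 to be 1. -/
theorem interpCoeff_eq_zero {H : F → F → F}
    (hH : ∀ a : F, a ≠ 0 → ∀ u z, H (a * u) (a * z) = a⁻¹ * H u z) {i j : ℕ}
    (hij : ¬ Fintype.card F - 1 ∣ i + j + 1) : interpCoeff H i j = 0 := by
  classical
  obtain ⟨g, hg⟩ := IsCyclic.exists_generator (α := Fˣ)
  by_contra h
  have h1 := interpCoeff_homogeneous g.ne_zero (hH g g.ne_zero) i j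
  have h2 : (g : F)⁻¹ ^ (i + j + 1) = 1 :=
    mul_right_cancel₀ h (h1.symm.trans (one_mul _).symm)
  rw [inv_pow, inv_eq_one] at h2
  have h3 : g ^ (i + j + 1) = 1 := Units.ext (by simpa using h2)
  refine hij ?_
  rw [← Fintype.card_units, ← Nat.card_eq_fintype_card, ← orderOf_eq_card_of_forall_mem_zpowers hg]
  exact orderOf_dvd_of_pow_eq_one h3

end Interpolation

/-! ### Polynomials in XY and Z, and their degrees. -/

section Polynomial

open MvPolynomial

variable {F : Type*} [Field F]

theorem C_mul_pow_mem_restrictDegree {n i j k : ℕ} (b : F) (hi : i ≤ n) (hj : j ≤ n)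
    (hk : k ≤ n) :
    (C b * X 0 ^ i * X 1 ^ j * X 2 ^ k : MvPolynomial (Fin 3) F) ∈
      restrictDegree (Fin 3) F n := by
  rw [mem_restrictDegree]
  have h : (C b * X 0 ^ i * X 1 ^ j * X 2 ^ k : MvPolynomial (Fin 3) F) =
      monomial (Finsupp.single 0 i + Finsupp.single 1 j + Finsupp.single 2 k) b := by
    simp only [X_pow_eq_monomial, C_mul_monomial, monomial_mul, mul_one]
  rw [h]
  intro s hs l
  have := Finset.mem_singleton.1 (support_monomial_subset hs)
  subst this
  fin_cases l <;> simpa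

/-- The polynomial `∑ b i j (X Y)^i Z^j` with `i, j < n`. -/
noncomputable def diagPoly (n : ℕ) (b : ℕ → ℕ → F) : MvPolynomial (Fin 3) F :=
  ∑ i ∈ Finset.range n, ∑ j ∈ Finset.range n, C (b i j) * (X 0 * X 1) ^ i * X 2 ^ j

theorem eval_diagPoly (n : ℕ) (b : ℕ → ℕ → F) (x y z : F) :
    eval ![x, y, z] (diagPoly n b) =
      ∑ i ∈ Finset.range n, ∑ j ∈ Finset.range n, b i j * (x * y) ^ i * z ^ j := by
  simp [diagPoly]

theorem mem_restrictDegree_of_diagPoly {n : ℕ} (hn : 1 ≤ n) (b : ℕ → ℕ → F) :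
    X 2 + X 0 * X 1 + X 0 * X 1 * X 2 * diagPoly (n - 1) b ∈ restrictDegree (Fin 3) F n := by
  refine add_mem (add_mem ?_ ?_) ?_
  · have h := C_mul_pow_mem_restrictDegree (1 : F) n.zero_le n.zero_le hn
    rwa [C_1, one_mul, pow_zero, pow_zero, one_mul, one_mul, pow_one] at h
  · have h := C_mul_pow_mem_restrictDegree (1 : F) hn hn n.zero_le
    rwa [C_1, one_mul, pow_zero, pow_one, pow_one, mul_one] at h
  · rw [diagPoly, Finset.mul_sum]
    refine sum_mem fun i hi => ?_
    rw [Finset.mul_sum]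
    refine sum_mem fun j hj => ?_
    rw [Finset.mem_range] at hi hj
    convert C_mul_pow_mem_restrictDegree (n := n) (i := i + 1) (j := i + 1) (k := j + 1) (b i j)
      (by omega) (by omega) (by omega) using 1
    ring

end Polynomial

/-! ### The coefficients of M₁. -/

namespace IsPTRPolynomial

open MvPolynomial

variable {F P L : Type*} [Field F] [Fintype F] [Membership P L] [ProjectivePlane P L]
  {c : Coordinatisation F P L} {T : MvPolynomial (Fin 3) F}

/-- The function `(x ⊕ z - x - z) / (x z)`, with value `0` where `x z = 0`. -/
noncomputable def addDefect (T : MvPolynomial (Fin 3) F) (x z : F) : F :=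
  (eval ![1, x, z] T - z - x) * x⁻¹ * z⁻¹

/-- Since x ↦ x ⊕ z is a permutation, ∑ (x ⊕ z) and ∑ x cancel, and the remaining ∑ z over x is q z
= 0. -/
theorem sum_addDefect_left (hT : IsPTRPolynomial c T)
    (hmul : ∀ x y : F, eval ![x, y, 0] T = x * y) (h : IsTransitive c.X c.lineOY) (z : F) :
    ∑ x, addDefect T x z * x = 0 := by
  have hb : Function.Bijective fun x => eval ![1, x, z] T := by
    rw [← Finite.injective_iff_bijective]
    have := eval_left_injective hT hmul one_ne_zero z
    simpa only [eval_eq_of_isTransitive_X hT hmul h _ 1, mul_one] using this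
  have h1 : ∀ x, addDefect T x z * x = (eval ![1, x, z] T - z - x) * z⁻¹ := fun x => by
    by_cases hx : x = 0
    · simp [hx, hT.eval_zero_mid]
    · rw [addDefect]
      field_simp
  simp_rw [h1, ← Finset.sum_mul, Finset.sum_sub_distrib]
  rw [hb.sum_comp fun x => x]
  simp

theorem sum_addDefect_right (hT : IsPTRPolynomial c T)
    (hmul : ∀ x y : F, eval ![x, y, 0] T = x * y) (x : F) :
    ∑ z, addDefect T x z * z = 0 := by
  have hb : Function.Bijective fun z => eval ![1, x, z] T :=
    Finite.injective_iff_bijective.1 (hT.eval_right_injective 1 x)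
  have h1 : ∀ z, addDefect T x z * z = (eval ![1, x, z] T - z - x) * x⁻¹ := fun z => by
    by_cases hz : z = 0
    · simp [hz, hmul]
    · rw [addDefect]
      field_simp
  simp_rw [h1, ← Finset.sum_mul, Finset.sum_sub_distrib]
  rw [hb.sum_comp fun x => x]
  simp

/-- The shape of the PTR polynomial of a linear plane with `x ⊙ y = x y`. -/
theorem eq_diagPoly (hT : IsPTRPolynomial c T)
    (hmul : ∀ x y : F, eval ![x, y, 0] T = x * y) (h : IsTransitive c.X c.lineOY) :
    T = X 2 + X 0 * X 1 +
      X 0 * X 1 * X 2 * diagPoly (Fintype.card F - 2) (interpCoeff (addDefect T)) := by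
  have hq : 1 < Fintype.card F := Fintype.one_lt_card
  have hT' : T ∈ restrictDegree (Fin 3) F (Fintype.card F - 1) := by
    rw [mem_restrictDegree]
    intro s hs i
    have := monomial_le_degreeOf i hs
    have := hT.reduced i
    omega
  rw [← sub_eq_zero]
  -- Both sides have degree at most q-1 in each variable, so agreement on F³ suffices.
  refine eq_zero_of_eval_zero_at_prod_finset _ (fun _ => Finset.univ) (fun i => ?_)
    (fun v _ => ?_)
  · have hmem := sub_mem hT' (mem_restrictDegree_of_diagPoly (n := Fintype.card F - 1) (by omega)
      (interpCoeff (addDefect T)))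
    rw [mem_restrictDegree] at hmem
    have := degreeOf_le_iff.2 fun s hs => hmem s hs i
    rw [Finset.card_univ]
    exact lt_of_le_of_lt this (by omega)
  · obtain ⟨x, y, z, rfl⟩ : ∃ x y z, v = ![x, y, z] :=
      ⟨v 0, v 1, v 2, by ext i; fin_cases i <;> rfl⟩
    rw [map_sub, sub_eq_zero, hT.eval_eq_of_isTransitive_X hmul h]
    simp only [map_add, map_mul, eval_X, eval_diagPoly, Matrix.cons_val]
    by_cases hxy : x * y = 0
    · simp [hxy, hT.eval_zero_mid]
    by_cases hz : z = 0
    · simp [hz, hmul]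
    rw [sum_interpCoeff (by simp [addDefect]) (by simp [addDefect])
      (hT.sum_addDefect_left hmul h) (hT.sum_addDefect_right hmul) hxy hz, addDefect]
    generalize x * y = u at *
    field_simp
    ring

theorem addDefect_homogeneous (hT : IsPTRPolynomial c T)
    (hmul : ∀ x y : F, eval ![x, y, 0] T = x * y) (h : IsTransitive c.O c.lineInf) {a : F}
    (ha : a ≠ 0) (x z : F) : addDefect T (a * x) (a * z) = a⁻¹ * addDefect T x z := by
  rw [addDefect, addDefect, hT.eval_smul_of_isTransitive_O hmul h ha, mul_inv, mul_inv]
  field_simp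

end IsPTRPolynomial

theorem diagPoly_eq_of_antidiagonal {F : Type*} [Field F] {q : ℕ} {b : ℕ → ℕ → F}
    (hb : ∀ i j, ¬ q - 1 ∣ i + j + 1 → b i j = 0) :
    diagPoly (q - 2) b = ∑ i ∈ Finset.range (q - 2),
      MvPolynomial.C (if i = 0 then 0 else b i (q - 2 - i)) *
        (MvPolynomial.X 0 * MvPolynomial.X 1) ^ i * MvPolynomial.X 2 ^ (q - 2 - i) := by
  refine Finset.sum_congr rfl fun i hi => ?_
  rw [Finset.mem_range] at hi
  have hz : ∀ j ∈ Finset.range (q - 2), i + j ≠ q - 2 → b i j = 0 := fun j hj hij => by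
    rw [Finset.mem_range] at hj
    -- Here 0 < i+j+1 < 2(q-1), so q-1 itself is the only possible multiple.
    refine hb i j fun hd => ?_
    obtain ⟨k, hk⟩ := hd
    have h1 : 1 ≤ k := by
      rcases k with _ | k <;> omega
    have h2 : k < 2 := by
      by_contra! h2
      have := Nat.mul_le_mul_left (q - 1) h2
      omega
    obtain rfl : k = 1 := by omega
    omega
  -- For i = 0 the partner j = q-2 is out of range, so the whole row vanishes; this is why the
  -- coefficient is set to 0 there.
  split_ifs with h0
  · rw [map_zero, zero_mul, zero_mul]
    refine Finset.sum_eq_zero fun j hj => ?_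
    rw [hz j hj (by have := Finset.mem_range.1 hj; omega), map_zero, zero_mul, zero_mul]
  · rw [Finset.sum_eq_single (q - 2 - i)]
    · intro j hj hne
      rw [hz j hj (by omega), map_zero, zero_mul, zero_mul]
    · intro hn
      exact absurd (Finset.mem_range.2 (by omega)) hn

end CoordPlane

theorem mainTheorem4 {F P L : Type*} [Field F] [Fintype F] [Finite P] [Finite L]
    [Membership P L] [Configuration.ProjectivePlane P L]
    (horder : Configuration.ProjectivePlane.order P L = Fintype.card F)
    (c : CoordPlane.Coordinatisation F P L)
    (htrans : CoordPlane.IsTransitive c.X c.lineOY)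
    (hcyclic : IsCyclic (CoordPlane.centralGroup c.X c.lineOY))
    (hopt : c.IsOptimal)
    (T : MvPolynomial (Fin 3) F) (hT : CoordPlane.IsPTRPolynomial c T)
    (hmul : ∀ x y : F, MvPolynomial.eval ![x, y, 0] T = x * y) :
    ∃ (b : ℕ → ℕ → F) (M₁ : MvPolynomial (Fin 3) F),
      M₁ = ∑ i ∈ Finset.range (Fintype.card F - 2), ∑ j ∈ Finset.range (Fintype.card F - 2),
        MvPolynomial.C (b i j) * (MvPolynomial.X 0 * MvPolynomial.X 1) ^ i *
          MvPolynomial.X 2 ^ j ∧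
      T = MvPolynomial.X 2 + MvPolynomial.X 0 * MvPolynomial.X 1 +
        MvPolynomial.X 0 * MvPolynomial.X 1 * MvPolynomial.X 2 * M₁ ∧
      (CoordPlane.IsTypeI4 P L →
        ∃ d : ℕ → F, M₁ = ∑ i ∈ Finset.range (Fintype.card F - 2),
          MvPolynomial.C (d i) * (MvPolynomial.X 0 * MvPolynomial.X 1) ^ i *
            MvPolynomial.X 2 ^ (Fintype.card F - 2 - i)) ∧
      (CoordPlane.IsTypeII2 P L →
        ∀ x y z s t : F,
          s = x + y + x * y * MvPolynomial.eval ![1, x, y] M₁ →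
          t = y + z + y * z * MvPolynomial.eval ![1, y, z] M₁ →
          (x + y) * z * MvPolynomial.eval ![1, s, z] M₁ +
              x * y * MvPolynomial.eval ![1, x, y] M₁ *
                (1 + z * MvPolynomial.eval ![1, s, z] M₁) =
            x * (y + z) * MvPolynomial.eval ![1, x, t] M₁ +
              y * z * MvPolynomial.eval ![1, y, z] M₁ *
                (1 + x * MvPolynomial.eval ![1, x, t] M₁)) := by

  refine ⟨_, CoordPlane.diagPoly (Fintype.card F - 2)
    (CoordPlane.interpCoeff (CoordPlane.IsPTRPolynomial.addDefect T)), rfl,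
    hT.eq_diagPoly hmul htrans, fun h4 => ?_, fun h2 x y z s t hs ht => ?_⟩
  · have hO := CoordPlane.IsTypeI4.isTransitive_O hopt h4
    exact ⟨_, CoordPlane.diagPoly_eq_of_antidiagonal fun i j =>
      CoordPlane.interpCoeff_eq_zero fun a ha => hT.addDefect_homogeneous hmul hO ha⟩
  · obtain ⟨A, B, a, b, hAa, hBb, hAb, hBa, hS⟩ := h2
    have hA : (A, a) ∈ CoordPlane.transitivities P L := hS ▸ Set.mem_insert _ _
    have hassoc := hT.eval_assoc_of_isTransitive_Y hmul (hopt.incident ⟨A, a, hAa, hA⟩) x y z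
    have hadd : ∀ u v, MvPolynomial.eval ![1, u, v] T = v + u + u * v *
        MvPolynomial.eval ![1, u, v] (CoordPlane.diagPoly (Fintype.card F - 2)
          (CoordPlane.interpCoeff (CoordPlane.IsPTRPolynomial.addDefect T))) := fun u v => by
      -- `T` also occurs on the right, inside `addDefect T`, and must stay there.
      conv_lhs => rw [hT.eq_diagPoly hmul htrans]
      simp
    have hs' : MvPolynomial.eval ![1, x, y] T = s := by rw [hadd, hs]; ring
    have ht' : MvPolynomial.eval ![1, y, z] T = t := by rw [hadd, ht]; ring
    rw [hs', ht', hadd, hadd] at hassoc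
    generalize CoordPlane.diagPoly (Fintype.card F - 2)
      (CoordPlane.interpCoeff (CoordPlane.IsPTRPolynomial.addDefect T)) = M at *
    -- With the values of M₁ at s and t made opaque before s and t are expanded, the claim is
    -- associativity up to ring identities.
    generalize MvPolynomial.eval ![1, s, z] M = Ms at *
    generalize MvPolynomial.eval ![1, x, t] M = Mt at *
    subst hs ht
    linear_combination -hassoc
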